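/- For $n\ge 0$, a perfect matching on $[2n]=\{1,\dots,2n\}$ is a set $M$ of $n$ pairs $(i,j)$ with $i<j$ such that each element of $[2n]$ appears in exactly one of the pairs. Given a permutation $\tau$ of $\{1,\dots,k\}$, the matching $M$ avoids $\tau$ if there are no vertices $1\le i_1<\dots<i_{2k}\le 2n$ such that $M$ contains all the pairs $(i_a,\,i_{2k+1-\tau(a)})$, $1\le a\le k$. Let $\mathcal{M}_n(\tau)$ be the set of $\tau$-avoiding perfect matchings on $[2n]$. Theorem. For all $n\ge 0$, $|\mathcal{M}_n(231)|=|\mathcal{M}_n(312)|$. The generating function is, as an identity of formal power series in $z$ over $\mathbb{Q}$, $$\sum_{n\ge 0}|\mathcal{M}_n(312)|\,z^n=\frac{54z}{1+36z-(1-12z)^{3/2}},$$ where $(1-12z)^{3/2}=\sum_{m\ge0}\binom{3/2}{m}(-12z)^m$, the denominator is a nonzero power series, and the quotient is taken in the field of formal Laurent series. Moreover, as $n\to\infty$, $$|\mathcal{M}_n(312)|\sim\frac{3^3}{2^7\sqrt{\pi n^5}}\,12^n.$$ -/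

import Mathlib

open Filter Asymptotics
open scoped PowerSeries LaurentSeries

/-- `M` is (the arc set of) a perfect matching on `2 * n` linearly ordered vertices: a set of `n`
pairs `(i, j)` with `i < j` such that each vertex appears in exactly one of the pairs.
The vertex set `{1, …, 2n}` is modelled by `Fin (2 * n)`. -/
def IsPerfectMatching {n : ℕ} (M : Finset (Fin (2 * n) × Fin (2 * n))) : Prop :=
  M.card = n ∧ (∀ p ∈ M, p.1 < p.2) ∧ ∀ v, ∃! p, p ∈ M ∧ (p.1 = v ∨ p.2 = v)

/-- `M` contains the pattern `τ` of length `k`: there are vertices `i₁ < ⋯ < i₂ₖ` such that `M`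
contains all pairs `(i_a, i_{2k+1-τ(a)})`, `1 ≤ a ≤ k`. With indices and values of `τ` starting
at `0`, the second index is `2k - 1 - τ(a)`. -/
def ContainsPattern {n k : ℕ} (M : Finset (Fin (2 * n) × Fin (2 * n)))
    (τ : Equiv.Perm (Fin k)) : Prop :=
  ∃ v : Fin (2 * k) → Fin (2 * n), StrictMono v ∧
    ∀ a : Fin k, (v ⟨a, by omega⟩, v ⟨2 * k - 1 - τ a, by omega⟩) ∈ M

/-- The set of `τ`-avoiding perfect matchings on `2 * n` vertices. -/
def avoidingMatchings {k : ℕ} (τ : Equiv.Perm (Fin k)) (n : ℕ) :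
    Set (Finset (Fin (2 * n) × Fin (2 * n))) :=
  {M | IsPerfectMatching M ∧ ¬ ContainsPattern M τ}

/-- The number of `τ`-avoiding perfect matchings on `2 * n` vertices. -/
noncomputable def numAvoiding {k : ℕ} (τ : Equiv.Perm (Fin k)) (n : ℕ) : ℕ :=
  (avoidingMatchings τ n).ncard

/-- The ordinary generating function of `τ`-avoiding perfect matchings, with exponent `n` for
matchings on `2 * n` vertices. -/
noncomputable def avoidingGF {k : ℕ} (τ : Equiv.Perm (Fin k)) : ℚ⟦X⟧ :=
  PowerSeries.mk fun n => (numAvoiding τ n : ℚ)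

/-- The permutation with one-line notation `312` (written with values `0, 1, 2`). -/
def perm312 : Equiv.Perm (Fin 3) where
  toFun := ![2, 0, 1]
  invFun := ![1, 2, 0]
  left_inv := by decide
  right_inv := by decide

/-- The permutation with one-line notation `231` (written with values `0, 1, 2`). -/
def perm231 : Equiv.Perm (Fin 3) where
  toFun := ![1, 2, 0]
  invFun := ![2, 0, 1]
  left_inv := by decide
  right_inv := by decide

/-- The formal power series `(1 - 12 z)^(3/2) = ∑ n, binom(3/2, n) (-12)^n z^n`. -/
noncomputable def oneSubTwelveXPow : ℚ⟦X⟧ :=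
  PowerSeries.rescale (-12 : ℚ) (PowerSeries.binomialSeries ℚ (3 / 2 : ℚ))

/-!
The pattern `231` is the mirror image of `312`, so reversing the order of the vertices exchanges the
two avoidance conditions (`numAvoiding_perm231`).

For `312`, scan the vertices from left to right and keep the list of open arcs. Three arcs form the
pattern when they are open simultaneously and closed in the order first, third, second. Hence, once
an arc `x` is closed, the arcs opened after `x` that are still open have to be closed in increasing
order. The open arcs thus fall into blocks, each to be closed from its least element upwards; a new
arc forms a block of its own, and closing the least element of a block merges what is left of it
with all later blocks. So the number of completions depends on the list of block sizes only
(`card_partialMatchings_eq_numCompletions`).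

Let `D` be such a list, with sum `h`. In a completion, consider the vertices up to the first one
after which fewer than `h` arcs are open. Their total effect on `D` is to merge the blocks `0, …, j`
for some `j` and to remove one element, and the weight `P j` of the ways to do so depends on `j`
only. This suggests the ansatz `completionSeries`. It satisfies the recursion for completions
provided that `P i = 1 + X (P 0 * P i + ∑ j ≤ i, P (j + 1) * P (i - j))` (`completionSeries_succ`),
and the generating function is then `1 / (1 - X * P 0)`. With a second variable marking `i` the
recursion is a quadratic equation with one catalytic variable. An explicit solution is checked in
`exists_weightSeries`; it has `P 0 = w (1 - X w ^ 2)`, the generating function of rooted planar maps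
by edges, where `w = 1 + 3 X w ^ 2`. Since `1 - 6 X w` is the square root of `1 - 12 X`, this is the
stated formula.

Rationalizing the denominator gives `2 (1 + 4 X) ^ 2 A = 1 + 36 X + (1 - 12 X) ^ (3 / 2)` for the
generating function `A` (`two_mul_avoidingGF`). The coefficients on the right are given by
Catalan numbers, whose asymptotics follow from Stirling's formula, and each of the two divisions by
`1 + 4 X` multiplies them asymptotically by `1 / (1 + 4 / 12)` (`tendsto_div_growth`).
-/

/-! ### Scanning a `312`-avoiding matching from left to right -/

/-- The part of a `312`-avoiding matching that is still to be drawn when a left-to-right scan has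
reached vertex `p`, the vertices being the natural numbers below `q`. The list `K` holds the left
ends of the arcs that are already open, grouped into blocks, the most recently opened first; `M`
consists of the arcs whose right end lies in `[p, q)`. Two elements of one block have to be closed
in increasing order, because an arc to the left of both was closed while both were open. This and
the absence of the pattern inside `M` is all that avoidance demands of `M`. -/
structure IsPartialMatching (p q : ℕ) (K : List (List ℕ)) (M : Finset (ℕ × ℕ)) : Prop where
  arc : ∀ i j, (i, j) ∈ M → i < j ∧ p ≤ j ∧ j < q ∧ (i ∈ K.flatten ∨ p ≤ i)
  cover : ∀ v, v ∈ K.flatten ∨ p ≤ v ∧ v < q → ∃ i j, (i, j) ∈ M ∧ (i = v ∨ j = v)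
  uniq : ∀ i j i' j' v, (i, j) ∈ M → (i', j') ∈ M → i = v ∨ j = v → i' = v ∨ j' = v →
    i = i' ∧ j = j'
  avoid : ∀ o₁ c₁ o₂ c₂ o₃ c₃, (o₁, c₁) ∈ M → (o₂, c₂) ∈ M → (o₃, c₃) ∈ M →
    o₁ < o₂ → o₂ < o₃ → o₃ < c₁ → c₁ < c₃ → c₃ < c₂ → False
  block : ∀ b ∈ K, ∀ y ∈ b, ∀ z ∈ b, y < z → ∀ c c', (y, c) ∈ M → (z, c') ∈ M → c < c'

/-- The list of blocks `K` is a legitimate state of the scan at vertex `p`: nonempty blocks of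
vertices below `p`, decreasing along the concatenation of all blocks. -/
structure IsState (p : ℕ) (K : List (List ℕ)) : Prop where
  ne_nil : ∀ b ∈ K, b ≠ []
  sorted : K.flatten.Pairwise (· > ·)
  lt : ∀ x ∈ K.flatten, x < p

/-- The state reached from `K` by closing the least element of block number `j`: the remainder of
that block and all blocks opened later are merged into one block. -/
def closeBlocks (j : ℕ) (K : List (List ℕ)) : List (List ℕ) :=
  if (K.take (j + 1)).flatten.dropLast = [] then K.drop (j + 1)
  else (K.take (j + 1)).flatten.dropLast :: K.drop (j + 1)

/-- The least element of block number `j` (for a legitimate state), the only element of that block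
which may be closed next. The default value `0` is never used. -/
def bottom (j : ℕ) (K : List (List ℕ)) : ℕ := (K.take (j + 1)).flatten.getLastD 0

theorem take_flatten_eq {p j : ℕ} {K : List (List ℕ)} (hK : IsState p K) (hj : j < K.length) :
    (K.take (j + 1)).flatten = (K.take (j + 1)).flatten.dropLast ++ [bottom j K] := by
  have h : (K.take (j + 1)).flatten ≠ [] := by
    rw [List.take_succ_eq_append_getElem hj, List.flatten_append, List.flatten_singleton]
    exact List.append_ne_nil_of_right_ne_nil _ (hK.ne_nil K[j] (List.getElem_mem hj))
  rw [bottom, List.getLastD_eq_getLast?, List.getLast?_eq_some_getLast h, Option.getD_some,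
    List.dropLast_append_getLast h]

theorem flatten_eq {p j : ℕ} {K : List (List ℕ)} (hK : IsState p K) (hj : j < K.length) :
    K.flatten = (K.take (j + 1)).flatten.dropLast ++ bottom j K :: (K.drop (j + 1)).flatten := by
  conv_lhs => rw [← List.take_append_drop (j + 1) K, List.flatten_append, take_flatten_eq hK hj]
  simp

theorem closeBlocks_flatten (j : ℕ) (K : List (List ℕ)) :
    (closeBlocks j K).flatten =
      (K.take (j + 1)).flatten.dropLast ++ (K.drop (j + 1)).flatten := by
  unfold closeBlocks
  split_ifs with h <;> simp [h]

theorem mem_flatten_iff {p j : ℕ} {K : List (List ℕ)} (hK : IsState p K) (hj : j < K.length)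
    (v : ℕ) : v ∈ K.flatten ↔ v = bottom j K ∨ v ∈ (closeBlocks j K).flatten := by
  rw [flatten_eq hK hj, closeBlocks_flatten]
  simp only [List.mem_append, List.mem_cons]
  tauto

theorem bottom_lt {p j : ℕ} {K : List (List ℕ)} (hK : IsState p K) (hj : j < K.length) {v : ℕ}
    (hv : v ∈ (K.take (j + 1)).flatten.dropLast) : bottom j K < v := by
  have := hK.sorted
  rw [flatten_eq hK hj, List.pairwise_append] at this
  exact this.2.2 v hv _ (by simp)

theorem lt_bottom {p j : ℕ} {K : List (List ℕ)} (hK : IsState p K) (hj : j < K.length) {v : ℕ}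
    (hv : v ∈ (K.drop (j + 1)).flatten) : v < bottom j K := by
  have := hK.sorted
  rw [flatten_eq hK hj, List.pairwise_append, List.pairwise_cons] at this
  exact this.2.1.1 v hv

theorem bottom_mem {p j : ℕ} {K : List (List ℕ)} (hK : IsState p K) (hj : j < K.length) :
    bottom j K ∈ K.flatten := by
  rw [mem_flatten_iff hK hj]; exact Or.inl rfl

theorem bottom_strictAnti {p i j : ℕ} {K : List (List ℕ)} (hK : IsState p K) (hij : i < j)
    (hj : j < K.length) : bottom j K < bottom i K := by
  refine lt_bottom hK (hij.trans hj) ?_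
  have h1 : bottom j K ∈ K[j] := by
    have h := hK.ne_nil K[j] (List.getElem_mem hj)
    rw [bottom, List.getLastD_eq_getLast?, List.take_succ_eq_append_getElem hj]
    rw [List.flatten_append, List.flatten_singleton, List.getLast?_append_of_ne_nil _ h,
      List.getLast?_eq_some_getLast h]
    exact List.getLast_mem h
  refine List.mem_flatten.2 ⟨K[j], ?_, h1⟩
  rw [List.mem_drop_iff_getElem]
  exact ⟨j - (i + 1), by omega, by congr 1; omega⟩

theorem IsState.push {p : ℕ} {K : List (List ℕ)} (hK : IsState p K) :
    IsState (p + 1) ([p] :: K) where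
  ne_nil b hb := by
    rcases List.mem_cons.1 hb with rfl | hb
    · simp
    · exact hK.ne_nil b hb
  sorted := by
    simp only [List.flatten_cons, List.singleton_append, List.pairwise_cons]
    exact ⟨fun x hx => hK.lt x hx, hK.sorted⟩
  lt x hx := by
    simp only [List.flatten_cons, List.singleton_append, List.mem_cons] at hx
    rcases hx with rfl | hx
    · omega
    · have := hK.lt x hx; omega

theorem IsState.close {p j : ℕ} {K : List (List ℕ)} (hK : IsState p K) (hj : j < K.length) :
    IsState (p + 1) (closeBlocks j K) where
  ne_nil b hb := by
    unfold closeBlocks at hb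
    split_ifs at hb with h
    · exact hK.ne_nil b (List.mem_of_mem_drop hb)
    · rcases List.mem_cons.1 hb with rfl | hb
      · exact h
      · exact hK.ne_nil b (List.mem_of_mem_drop hb)
  sorted := by
    rw [closeBlocks_flatten]
    refine hK.sorted.sublist ?_
    rw [flatten_eq hK hj]
    exact (List.Sublist.refl _).append (List.sublist_cons_self _ _)
  lt x hx := by
    have := hK.lt x ((mem_flatten_iff hK hj x).2 (Or.inr hx))
    omega

/-- The partial matchings in which `p` is a left end are those of the state with the new block
`[p]`. -/
theorem isPartialMatching_push_iff {p q : ℕ} {K : List (List ℕ)} (hK : IsState p K) (hpq : p < q)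
    (M : Finset (ℕ × ℕ)) :
    IsPartialMatching (p + 1) q ([p] :: K) M ↔
      IsPartialMatching p q K M ∧ ∃ c, (p, c) ∈ M := by
  have hlt := hK.lt
  have hmem : ∀ v, v ∈ ([p] :: K).flatten ↔ v = p ∨ v ∈ K.flatten := by simp
  constructor
  · intro h
    refine ⟨⟨fun i j hij => ?_, fun v hv => h.cover v ?_, h.uniq, h.avoid,
      fun b hb => h.block b ?_⟩, ?_⟩
    · have := h.arc i j hij
      rw [hmem] at this
      grind
    · rw [hmem]; grind
    · exact List.mem_cons_of_mem _ hb
    · obtain ⟨i, j, hij, hv⟩ := h.cover p (by simp)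
      have := h.arc i j hij
      have : i = p := by grind
      exact ⟨j, this ▸ hij⟩
  · rintro ⟨h, c, hc⟩
    refine ⟨fun i j hij => ?_, fun v hv => h.cover v ?_, h.uniq, h.avoid, fun b hb => ?_⟩
    · have h1 := h.arc i j hij
      have h2 := h.arc p c hc
      rw [hmem]
      have : j ≠ p := fun hj => by
        have := h.uniq i j p c p hij hc (Or.inr hj) (Or.inl rfl)
        grind
      grind
    · rw [hmem] at hv; grind
    · rcases List.mem_cons.1 hb with rfl | hb
      · intro y hy z hz hyz
        simp only [List.mem_singleton] at hy hz
        grind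
      · exact h.block b hb

/-- Closing `bottom j K` at `p` forces all open arcs above it into one increasing block: otherwise
two of them would form the pattern together with the arc closed at `p`. -/
theorem isPartialMatching_close {p q j : ℕ} {K : List (List ℕ)} (hK : IsState p K)
    (hj : j < K.length) {M : Finset (ℕ × ℕ)} (h : IsPartialMatching p q K M)
    (hx : (bottom j K, p) ∈ M) :
    IsPartialMatching (p + 1) q (closeBlocks j K) (M.erase (bottom j K, p)) := by
  have hmem := mem_flatten_iff hK hj
  have hlt := hK.lt
  set x := bottom j K with hxdef
  have hxp : x < p := hlt x (bottom_mem hK hj)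
  -- an arc other than `(x, p)` shares no endpoint with it
  have hne : ∀ i k, (i, k) ∈ M.erase (x, p) → (i, k) ∈ M ∧ i ≠ x ∧ i ≠ p ∧ k ≠ x ∧ k ≠ p := by
    intro i k hik
    have hik' := Finset.mem_of_mem_erase hik
    have hne := Finset.ne_of_mem_erase hik
    have h1 : ∀ v, i = v ∨ k = v → ¬ (x = v ∨ p = v) := fun v hv hv' => hne (by
      obtain ⟨rfl, rfl⟩ := h.uniq i k x p v hik' hx hv hv'
      rfl)
    have := h1 x
    have := h1 p
    refine ⟨hik', ?_⟩
    tauto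
  refine ⟨fun i k hik => ?_, fun v hv => ?_, fun i k i' k' v h1 h2 => ?_, ?_, ?_⟩
  · obtain ⟨h0, h1⟩ := hne i k hik
    have := h.arc i k h0
    rw [hmem] at this
    grind
  · have hvx : v ≠ x := by
      rintro rfl
      rcases hv with hv | hv
      · rw [closeBlocks_flatten, List.mem_append] at hv
        rcases hv with hv | hv
        · exact absurd (bottom_lt hK hj hv) (by grind)
        · exact absurd (lt_bottom hK hj hv) (by grind)
      · grind
    have hvp : v ≠ p := by
      rintro rfl
      rcases hv with hv | hv
      · exact absurd (hlt v ((hmem v).2 (Or.inr hv))) (by grind)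
      · grind
    obtain ⟨i, k, hik, hv'⟩ := h.cover v (by rw [hmem]; grind)
    refine ⟨i, k, Finset.mem_erase.2 ⟨?_, hik⟩, hv'⟩
    rintro ⟨⟩
    grind
  · exact h.uniq i k i' k' v (Finset.mem_of_mem_erase h1) (Finset.mem_of_mem_erase h2)
  · intro o₁ c₁ o₂ c₂ o₃ c₃ h1 h2 h3
    exact h.avoid o₁ c₁ o₂ c₂ o₃ c₃ (Finset.mem_of_mem_erase h1) (Finset.mem_of_mem_erase h2)
      (Finset.mem_of_mem_erase h3)
  · intro b hb y hy z hz hyz c c' hc hc'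
    have hcase : b = (K.take (j + 1)).flatten.dropLast ∨ b ∈ K.drop (j + 1) := by
      unfold closeBlocks at hb
      split_ifs at hb
      · exact Or.inr hb
      · exact List.mem_cons.1 hb
    rcases hcase with rfl | hb'
    · have hy' := bottom_lt hK hj hy
      obtain ⟨hcM, hc1⟩ := hne y c hc
      obtain ⟨hcM', hc1'⟩ := hne z c' hc'
      have hzp : z < p :=
        hlt z ((hmem z).2 (Or.inr (by rw [closeBlocks_flatten]; simp [hz])))
      have h1 := h.arc y c hcM
      have h2 := h.arc z c' hcM'
      -- if `z` were closed before `y`, then `x`, `y`, `z` would form the pattern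
      by_contra hcc
      have hcc' : c ≠ c' := by
        rintro rfl
        have := h.uniq y c z c c hcM hcM' (Or.inr rfl) (Or.inr rfl)
        grind
      exact h.avoid x p y c z c' hx hcM hcM' hy' hyz hzp (by grind) (by grind)
    · exact h.block b (List.mem_of_mem_drop hb') y hy z hz hyz c c' (Finset.mem_of_mem_erase hc)
        (Finset.mem_of_mem_erase hc')

/-- Conversely, the arc closed at `p` creates no pattern: it would have to play the role of `1`, the
first arc to be closed, and the other two arcs would lie in the merged block in the wrong
order. -/
theorem isPartialMatching_insert {p q j : ℕ} {K : List (List ℕ)} (hK : IsState p K) (hpq : p < q)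
    (hj : j < K.length) {M : Finset (ℕ × ℕ)}
    (h : IsPartialMatching (p + 1) q (closeBlocks j K) M) :
    IsPartialMatching p q K (insert (bottom j K, p) M) := by
  have hmem := mem_flatten_iff hK hj
  have hlt := hK.lt
  have hxnot : bottom j K ∉ (closeBlocks j K).flatten := fun hv => by
    rw [closeBlocks_flatten, List.mem_append] at hv
    rcases hv with hv | hv
    · exact absurd (bottom_lt hK hj hv) (by grind)
    · exact absurd (lt_bottom hK hj hv) (by grind)
  have habove : ∀ y ∈ K.flatten, bottom j K < y → y ∈ (K.take (j + 1)).flatten.dropLast := by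
    intro y hy hxy
    rw [flatten_eq hK hj, List.mem_append, List.mem_cons] at hy
    rcases hy with hy | hy | hy
    · exact hy
    · grind
    · exact absurd (lt_bottom hK hj hy) (by grind)
  have hblock : ∀ y ∈ (K.take (j + 1)).flatten.dropLast, ∀ z ∈ (K.take (j + 1)).flatten.dropLast,
      y < z → ∀ c c', (y, c) ∈ M → (z, c') ∈ M → c < c' := by
    intro y hy
    refine h.block _ ?_ y hy
    unfold closeBlocks
    rw [if_neg (List.ne_nil_of_mem hy)]
    exact List.mem_cons_self
  have hxp : bottom j K < p := hlt _ (bottom_mem hK hj)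
  set x := bottom j K with hxdef
  have hM : ∀ i k, (i, k) ∈ M →
      i < k ∧ p < k ∧ k < q ∧ i ≠ x ∧ i ≠ p ∧ (i ∈ K.flatten ∨ p ≤ i) := by
    intro i k hik
    have h1 := h.arc i k hik
    have h2 : i ≠ x := by rintro rfl; grind
    have h3 : i ≠ p := by
      rintro rfl
      rcases h1.2.2.2 with h4 | h4
      · exact absurd (hlt _ ((hmem _).2 (Or.inr h4))) (by grind)
      · grind
    rw [hmem]
    grind
  have hins : ∀ i k, (i, k) ∈ insert (x, p) M ↔ (i = x ∧ k = p) ∨ (i, k) ∈ M := by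
    intro i k; simp
  refine ⟨fun i k hik => ?_, fun v hv => ?_, fun i k i' k' v h1 h2 hv hv' => ?_, ?_, ?_⟩
  · rw [hins] at hik
    rcases hik with ⟨rfl, rfl⟩ | hik
    · exact ⟨hxp, le_rfl, hpq, Or.inl (bottom_mem hK hj)⟩
    · have := hM i k hik
      grind
  · rw [hmem] at hv
    by_cases hvxp : v = x ∨ v = p
    · exact ⟨x, p, by simp, by grind⟩
    · obtain ⟨i, k, hik, h1⟩ := h.cover v (by grind)
      exact ⟨i, k, Finset.mem_insert_of_mem hik, h1⟩
  · rw [hins] at h1 h2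
    rcases h1 with ⟨rfl, rfl⟩ | h1 <;> rcases h2 with ⟨rfl, rfl⟩ | h2
    · exact ⟨rfl, rfl⟩
    · have := hM _ _ h2; grind
    · have := hM _ _ h1; grind
    · exact h.uniq i k i' k' v h1 h2 hv hv'
  · intro o₁ c₁ o₂ c₂ o₃ c₃ h1 h2 h3 h12 h23 h31 hc13 hc32
    rw [hins] at h1 h2 h3
    -- `(x, p)` has the smallest right end, so it can only be the arc closed first
    rcases h2 with ⟨rfl, rfl⟩ | h2
    · rcases h1 with ⟨rfl, rfl⟩ | h1
      · grind
      · have := hM _ _ h1; grind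
    rcases h3 with ⟨rfl, rfl⟩ | h3
    · rcases h1 with ⟨rfl, rfl⟩ | h1
      · grind
      · have := hM _ _ h1; grind
    rcases h1 with ⟨rfl, rfl⟩ | h1
    · have h2' := hM _ _ h2
      have h3' := hM _ _ h3
      have a2 : o₂ ∈ K.flatten := by grind
      have a3 : o₃ ∈ K.flatten := by grind
      have := hblock o₂ (habove _ a2 h12) o₃ (habove _ a3 (h12.trans h23)) h23 c₂ c₃ h2 h3
      grind
    · exact h.avoid o₁ c₁ o₂ c₂ o₃ c₃ h1 h2 h3 h12 h23 h31 hc13 hc32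
  · intro b hb y hy z hz hyz c c' hc hc'
    rw [hins] at hc hc'
    have hbt : b ∈ K.take (j + 1) ∨ b ∈ K.drop (j + 1) := by
      rwa [← List.mem_append, List.take_append_drop]
    rcases hc with ⟨rfl, rfl⟩ | hc <;> rcases hc' with ⟨rfl, rfl⟩ | hc'
    · grind
    · exact (hM _ _ hc').2.1
    · rcases hbt with hb | hb
      · rcases List.mem_append.1 (take_flatten_eq hK hj ▸ List.mem_flatten.2 ⟨b, hb, hy⟩)
          with h1 | h1
        · exact absurd (bottom_lt hK hj h1) (by omega)
        · exact absurd (List.mem_singleton.1 h1) (by omega)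
      · exact absurd (lt_bottom hK hj (List.mem_flatten.2 ⟨b, hb, hz⟩)) (by omega)
    · have hyx := (hM _ _ hc).2.2.2.1
      have hzx := (hM _ _ hc').2.2.2.1
      rcases hbt with hb | hb
      · have hcase : ∀ v ∈ b, v ≠ x → v ∈ (K.take (j + 1)).flatten.dropLast := by
          intro v hv hvx
          rcases List.mem_append.1 (take_flatten_eq hK hj ▸ List.mem_flatten.2 ⟨b, hb, hv⟩)
            with h1 | h1
          · exact h1
          · exact absurd (List.mem_singleton.1 h1) hvx
        exact hblock y (hcase y hy hyx) z (hcase z hz hzx) hyz c c' hc hc'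
      · refine h.block b ?_ y hy z hz hyz c c' hc hc'
        unfold closeBlocks
        split_ifs
        · exact hb
        · exact List.mem_cons_of_mem _ hb

/-- At vertex `p`, either an arc is opened or the least element of some block is closed. -/
theorem exists_open_or_close {p q : ℕ} {K : List (List ℕ)} (hK : IsState p K) (hpq : p < q)
    {M : Finset (ℕ × ℕ)} (h : IsPartialMatching p q K M) :
    (∃ c, (p, c) ∈ M) ∨ ∃ j < K.length, (bottom j K, p) ∈ M := by
  obtain ⟨x, c, hxc, rfl | rfl⟩ := h.cover p (Or.inr ⟨le_rfl, hpq⟩)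
  · exact Or.inl ⟨c, hxc⟩
  right
  have hx := h.arc x c hxc
  have hxK : x ∈ K.flatten := by grind
  obtain ⟨b, hb, hxb⟩ := List.mem_flatten.1 hxK
  obtain ⟨j, hj, rfl⟩ := List.getElem_of_mem hb
  refine ⟨j, hj, ?_⟩
  have h0 := hK.ne_nil K[j] hb
  have hbot : bottom j K = K[j].getLast h0 := by
    rw [bottom, List.getLastD_eq_getLast?, List.take_succ_eq_append_getElem hj,
      List.flatten_append, List.flatten_singleton, List.getLast?_append_of_ne_nil _ h0,
      List.getLast?_eq_some_getLast h0, Option.getD_some]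
  have hmem : bottom j K ∈ K[j] := hbot ▸ List.getLast_mem h0
  have hle : bottom j K ≤ x := by
    have hs : K[j].Pairwise (· > ·) := hK.sorted.sublist (List.sublist_flatten_of_mem hb)
    rw [hbot]
    rw [← List.dropLast_append_getLast h0, List.pairwise_append] at hs
    rw [← List.dropLast_append_getLast h0, List.mem_append, List.mem_singleton] at hxb
    rcases hxb with hxb | hxb
    · exact (hs.2.2 x hxb _ (by simp)).le
    · exact hxb.ge
  rcases hle.eq_or_lt with hle | hlt
  · rwa [hle]
  · exfalso
    obtain ⟨i, k, hik, hv⟩ := h.cover (bottom j K) (Or.inl (bottom_mem hK hj))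
    have h1 := h.arc i k hik
    have h2 := hK.lt _ (bottom_mem hK hj)
    obtain rfl : i = bottom j K := by grind
    have := h.block _ hb _ hmem x hxb hlt k c hik hxc
    grind

/-! ### Counting completions of a partial matching -/

open Classical in
/-- The finite set of all partial matchings of a given state. -/
noncomputable def partialMatchings (p q : ℕ) (K : List (List ℕ)) : Finset (Finset (ℕ × ℕ)) :=
  ((Finset.range q ×ˢ Finset.range q).powerset).filter fun M => IsPartialMatching p q K M

theorem mem_partialMatchings {p q : ℕ} {K : List (List ℕ)} {M : Finset (ℕ × ℕ)} :
    M ∈ partialMatchings p q K ↔ IsPartialMatching p q K M := by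
  classical
  rw [partialMatchings, Finset.mem_filter, Finset.mem_powerset, and_iff_right_iff_imp]
  rintro h ⟨i, j⟩ hij
  have := h.arc i j hij
  simp only [Finset.mem_product, Finset.mem_range]
  omega

theorem card_partialMatchings_self (p : ℕ) {K : List (List ℕ)} (hK : IsState p K) :
    (partialMatchings p p K).card = if K = [] then 1 else 0 := by
  have hM : ∀ {M}, IsPartialMatching p p K M → M = ∅ := fun {M} h =>
    Finset.eq_empty_of_forall_notMem fun ⟨i, j⟩ hij => by
      have := h.arc i j hij
      omega
  split_ifs with hnil
  · subst hnil
    rw [Finset.card_eq_one]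
    refine ⟨∅, Finset.eq_singleton_iff_unique_mem.2 ⟨?_, fun M h => hM (mem_partialMatchings.1 h)⟩⟩
    rw [mem_partialMatchings]
    refine ⟨by simp, fun v hv => ?_, by simp, by simp, by simp⟩
    simp only [List.flatten_nil, List.not_mem_nil, false_or] at hv
    omega
  · rw [Finset.card_eq_zero]
    refine Finset.eq_empty_of_forall_notMem fun M h => ?_
    rw [mem_partialMatchings] at h
    obtain ⟨b, hb⟩ := List.exists_mem_of_ne_nil K hnil
    obtain ⟨x, hx⟩ := List.exists_mem_of_ne_nil b (hK.ne_nil b hb)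
    obtain ⟨i, j, hij, -⟩ := h.cover x (Or.inl (List.mem_flatten.2 ⟨b, hb, hx⟩))
    simp [hM h] at hij

open Classical in
theorem partialMatchings_eq_union {p q : ℕ} {K : List (List ℕ)} (hK : IsState p K) (hpq : p < q) :
    partialMatchings p q K = partialMatchings (p + 1) q ([p] :: K) ∪
      (Finset.range K.length).biUnion fun j =>
        (partialMatchings (p + 1) q (closeBlocks j K)).image (insert (bottom j K, p)) := by
  ext M
  simp only [Finset.mem_union, Finset.mem_biUnion, Finset.mem_image, Finset.mem_range,
    mem_partialMatchings, isPartialMatching_push_iff hK hpq]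
  constructor
  · intro h
    rcases exists_open_or_close hK hpq h with h1 | ⟨j, hj, hx⟩
    · exact Or.inl ⟨h, h1⟩
    · exact Or.inr ⟨j, hj, _, isPartialMatching_close hK hj h hx, Finset.insert_erase hx⟩
  · rintro (h | ⟨j, hj, M, h, rfl⟩)
    · exact h.1
    · exact isPartialMatching_insert hK hpq hj h

/-- The recursion obtained by looking at the next vertex `p`. -/
theorem card_partialMatchings {p q : ℕ} {K : List (List ℕ)} (hK : IsState p K) (hpq : p < q) :
    (partialMatchings p q K).card = (partialMatchings (p + 1) q ([p] :: K)).card +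
      ∑ j ∈ Finset.range K.length, (partialMatchings (p + 1) q (closeBlocks j K)).card := by
  classical
  rw [partialMatchings_eq_union hK hpq, Finset.card_union_of_disjoint, Finset.card_biUnion]
  · congr 1
    refine Finset.sum_congr rfl fun j hj => Finset.card_image_of_injOn ?_
    have hnot : ∀ M ∈ partialMatchings (p + 1) q (closeBlocks j K), (bottom j K, p) ∉ M := by
      intro M hM hx
      have := (mem_partialMatchings.1 hM).arc _ _ hx
      omega
    intro M hM M' hM' h
    rw [← Finset.erase_insert (hnot M hM), ← Finset.erase_insert (hnot M' hM')]
    exact congrArg (fun N => Finset.erase N _) h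
  · intro i hi j hj hij
    rw [Finset.mem_coe, Finset.mem_range] at hi hj
    change Disjoint _ _
    rw [Finset.disjoint_left]
    simp only [Finset.mem_image, mem_partialMatchings]
    rintro _ ⟨M, hM, rfl⟩ ⟨M', hM', h⟩
    have h1 := isPartialMatching_insert hK hpq hi hM
    have hx : (bottom j K, p) ∈ insert (bottom i K, p) M := h ▸ Finset.mem_insert_self _ _
    have heq := (h1.uniq _ _ _ _ p hx (Finset.mem_insert_self _ _) (Or.inr rfl) (Or.inr rfl)).1
    rcases lt_or_gt_of_ne hij with hij | hij
    · exact absurd (bottom_strictAnti hK hij hj) (by omega)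
    · exact absurd (bottom_strictAnti hK hij hi) (by omega)
  · rw [Finset.disjoint_left]
    simp only [Finset.mem_biUnion, Finset.mem_image, mem_partialMatchings, Finset.mem_range,
      isPartialMatching_push_iff hK hpq]
    rintro _ ⟨h, c, hc⟩ ⟨j, hj, M, hM, rfl⟩
    have hx := h.uniq _ _ _ _ p hc (Finset.mem_insert_self _ _) (Or.inl rfl) (Or.inr rfl)
    have := h.arc _ _ hc
    omega

/-- The effect of `closeBlocks` on the list of block sizes: blocks `0, …, j` are merged and one
element is removed; an empty block is dropped. -/
def closeSizes (j : ℕ) (D : List ℕ) : List ℕ :=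
  if (D.take (j + 1)).sum = 1 then D.drop (j + 1)
  else ((D.take (j + 1)).sum - 1) :: D.drop (j + 1)

/-- The number of ways to complete, in `N` more vertices, a `312`-avoiding matching whose open arcs
form blocks of sizes `D`. -/
def numCompletions : ℕ → List ℕ → ℕ
  | 0, D => if D = [] then 1 else 0
  | N + 1, D => numCompletions N (1 :: D) +
      ∑ j ∈ Finset.range D.length, numCompletions N (closeSizes j D)

theorem map_length_closeBlocks {p j : ℕ} {K : List (List ℕ)} (hK : IsState p K)
    (hj : j < K.length) :
    (closeBlocks j K).map List.length = closeSizes j (K.map List.length) := by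
  have h : ((K.map List.length).take (j + 1)).sum =
      (K.take (j + 1)).flatten.dropLast.length + 1 := by
    rw [← List.map_take, ← List.length_flatten, take_flatten_eq hK hj, List.dropLast_concat]
    simp
  unfold closeBlocks closeSizes
  rw [h, ← List.map_drop]
  simp only [Nat.add_eq_right, List.length_eq_zero_iff]
  split_ifs <;> simp

theorem card_partialMatchings_eq_numCompletions (N : ℕ) :
    ∀ {p : ℕ} {K : List (List ℕ)}, IsState p K →
      (partialMatchings p (p + N) K).card = numCompletions N (K.map List.length) := by
  induction N with
  | zero => intro p K hK; simp [card_partialMatchings_self p hK, numCompletions]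
  | succ N ih =>
    intro p K hK
    rw [card_partialMatchings hK (by omega), numCompletions, List.length_map,
      show p + (N + 1) = p + 1 + N by omega, ih hK.push]
    congr 1
    refine Finset.sum_congr rfl fun j hj => ?_
    rw [Finset.mem_range] at hj
    rw [ih (hK.close hj), map_length_closeBlocks hK hj]

/-! ### Patterns in matchings, reflection, and the transfer to natural numbers -/

/-- Three arcs form the pattern `312` when all are open at once and their right ends come in the
order first, third, second. -/
theorem containsPattern_perm312_iff {n : ℕ} (M : Finset (Fin (2 * n) × Fin (2 * n))) :
    ContainsPattern M perm312 ↔ ∃ o₁ c₁ o₂ c₂ o₃ c₃, (o₁, c₁) ∈ M ∧ (o₂, c₂) ∈ M ∧ (o₃, c₃) ∈ M ∧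
      o₁ < o₂ ∧ o₂ < o₃ ∧ o₃ < c₁ ∧ c₁ < c₃ ∧ c₃ < c₂ := by
  constructor
  · rintro ⟨v, hv, h⟩
    have h0 := h 0
    have h1 := h 1
    have h2 := h 2
    refine ⟨_, _, _, _, _, _, h0, h1, h2, ?_, ?_, ?_, ?_, ?_⟩ <;> apply hv <;> decide
  · rintro ⟨o₁, c₁, o₂, c₂, o₃, c₃, h1, h2, h3, h⟩
    refine ⟨![o₁, o₂, o₃, c₁, c₃, c₂], ?_, ?_⟩
    · refine Fin.strictMono_iff_lt_succ (n := 5).2 fun i => ?_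
      fin_cases i
      exacts [h.1, h.2.1, h.2.2.1, h.2.2.2.1, h.2.2.2.2]
    · intro a
      fin_cases a
      exacts [h1, h2, h3]

/-- Three arcs form the pattern `231` when all are open at once and their right ends come in the
order second, first, third. -/
theorem containsPattern_perm231_iff {n : ℕ} (M : Finset (Fin (2 * n) × Fin (2 * n))) :
    ContainsPattern M perm231 ↔ ∃ o₁ c₁ o₂ c₂ o₃ c₃, (o₁, c₁) ∈ M ∧ (o₂, c₂) ∈ M ∧ (o₃, c₃) ∈ M ∧
      o₁ < o₂ ∧ o₂ < o₃ ∧ o₃ < c₂ ∧ c₂ < c₁ ∧ c₁ < c₃ := by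
  constructor
  · rintro ⟨v, hv, h⟩
    have h0 := h 0
    have h1 := h 1
    have h2 := h 2
    refine ⟨_, _, _, _, _, _, h0, h1, h2, ?_, ?_, ?_, ?_, ?_⟩ <;> apply hv <;> decide
  · rintro ⟨o₁, c₁, o₂, c₂, o₃, c₃, h1, h2, h3, h⟩
    refine ⟨![o₁, o₂, o₃, c₂, c₁, c₃], ?_, ?_⟩
    · refine Fin.strictMono_iff_lt_succ (n := 5).2 fun i => ?_
      fin_cases i
      exacts [h.1, h.2.1, h.2.2.1, h.2.2.2.1, h.2.2.2.2]
    · intro a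
      fin_cases a
      exacts [h1, h2, h3]

/-- The reflection of sets of arcs that reverses the order of the vertices. -/
def mirror {n : ℕ} : Equiv.Perm (Finset (Fin (2 * n) × Fin (2 * n))) :=
  Equiv.finsetCongr ((Equiv.prodComm _ _).trans (Equiv.prodCongr Fin.revPerm Fin.revPerm))

theorem mem_mirror {n : ℕ} {M : Finset (Fin (2 * n) × Fin (2 * n))} {i j : Fin (2 * n)} :
    (i, j) ∈ mirror M ↔ (j.rev, i.rev) ∈ M := by
  rw [mirror, Equiv.finsetCongr_apply, Finset.mem_map_equiv]
  rfl

theorem mirror_mirror {n : ℕ} (M : Finset (Fin (2 * n) × Fin (2 * n))) :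
    mirror (mirror M) = M := by
  ext ⟨i, j⟩
  simp [mem_mirror]

theorem IsPerfectMatching.mirror {n : ℕ} {M : Finset (Fin (2 * n) × Fin (2 * n))}
    (h : IsPerfectMatching M) : IsPerfectMatching (mirror M) := by
  refine ⟨by simpa [_root_.mirror] using h.1, fun ⟨i, j⟩ hij => ?_, fun v => ?_⟩
  · exact Fin.rev_lt_rev.1 (h.2.1 _ (mem_mirror.1 hij))
  · obtain ⟨⟨i, j⟩, ⟨hij, hv⟩, huniq⟩ := h.2.2 v.rev
    refine ⟨(j.rev, i.rev), ⟨by simpa [mem_mirror] using hij, ?_⟩, ?_⟩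
    · simp only [Fin.rev_eq_iff]
      exact hv.symm
    · rintro ⟨i', j'⟩ ⟨hij', hv'⟩
      have := huniq (j'.rev, i'.rev) ⟨mem_mirror.1 hij', by
        simp only [Fin.rev_inj]; exact hv'.symm⟩
      simp only [Prod.mk.injEq] at this
      simp [← this.1, ← this.2]

theorem containsPattern_mirror {n : ℕ} (M : Finset (Fin (2 * n) × Fin (2 * n))) :
    ContainsPattern (mirror M) perm312 ↔ ContainsPattern M perm231 := by
  rw [containsPattern_perm312_iff, containsPattern_perm231_iff]
  constructor
  · rintro ⟨o₁, c₁, o₂, c₂, o₃, c₃, h1, h2, h3, h⟩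
    refine ⟨_, _, _, _, _, _, mem_mirror.1 h2, mem_mirror.1 h3, mem_mirror.1 h1, ?_⟩
    simp only [Fin.rev_lt_rev]
    tauto
  · rintro ⟨o₁, c₁, o₂, c₂, o₃, c₃, h1, h2, h3, h⟩
    refine ⟨c₃.rev, o₃.rev, c₁.rev, o₁.rev, c₂.rev, o₂.rev, ?_, ?_, ?_, ?_⟩
    · simpa [mem_mirror] using h3
    · simpa [mem_mirror] using h1
    · simpa [mem_mirror] using h2
    · simp only [Fin.rev_lt_rev]
      tauto

theorem numAvoiding_perm231 (n : ℕ) : numAvoiding perm231 n = numAvoiding perm312 n := by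
  have h : avoidingMatchings perm312 n = mirror '' avoidingMatchings perm231 n := by
    ext M
    constructor
    · intro hM
      refine ⟨mirror M, ⟨hM.1.mirror, ?_⟩, mirror_mirror M⟩
      rw [← containsPattern_mirror, mirror_mirror]
      exact hM.2
    · rintro ⟨M, hM, rfl⟩
      exact ⟨hM.1.mirror, fun hc => hM.2 ((containsPattern_mirror M).1 hc)⟩
  rw [numAvoiding, numAvoiding, h, Set.ncard_image_of_injective _ mirror.injective]

/-- Double counting of the vertices; it supplies the cardinality demanded by
`IsPerfectMatching`. -/
theorem two_mul_card_eq {p q : ℕ} {M : Finset (ℕ × ℕ)} (h : IsPartialMatching p q [] M) :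
    2 * M.card = q - p := by
  have h1 : M.biUnion (fun a => {a.1, a.2}) = Finset.Ico p q := by
    ext v
    simp only [Finset.mem_biUnion, Finset.mem_insert, Finset.mem_singleton, Finset.mem_Ico]
    constructor
    · rintro ⟨⟨i, j⟩, hij, hv⟩
      have := h.arc i j hij
      simp only [List.flatten_nil, List.not_mem_nil, false_or] at this
      simp only at hv
      omega
    · intro hv
      obtain ⟨i, j, hij, h⟩ := h.cover v (Or.inr hv)
      exact ⟨(i, j), hij, by simp only; omega⟩
  rw [← Nat.card_Ico, ← h1, Finset.card_biUnion, Finset.sum_congr rfl (g := fun _ => 2),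
    Finset.sum_const, smul_eq_mul, mul_comm]
  · rintro ⟨i, j⟩ hij
    exact Finset.card_pair (h.arc i j hij).1.ne
  · rintro ⟨i, j⟩ hij ⟨i', j'⟩ hij' hne
    rw [Function.onFun, Finset.disjoint_left]
    intro v hv hv'
    simp only [Finset.mem_insert, Finset.mem_singleton] at hv hv'
    have := h.uniq i j i' j' v hij hij' (by omega) (by omega)
    exact hne (by rw [this.1, this.2])

/-- A set of arcs on `Fin (2 * n)` as a set of arcs on the natural numbers. -/
def arcsToNat (n : ℕ) (M : Finset (Fin (2 * n) × Fin (2 * n))) : Finset (ℕ × ℕ) :=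
  M.map (Fin.valEmbedding.prodMap Fin.valEmbedding)

theorem mem_arcsToNat {n : ℕ} {M : Finset (Fin (2 * n) × Fin (2 * n))} {i j : ℕ} :
    (i, j) ∈ arcsToNat n M ↔ ∃ a b : Fin (2 * n), (a, b) ∈ M ∧ (a : ℕ) = i ∧ (b : ℕ) = j := by
  simp [arcsToNat]

theorem val_mem_arcsToNat {n : ℕ} {M : Finset (Fin (2 * n) × Fin (2 * n))} {i j : Fin (2 * n)} :
    ((i : ℕ), (j : ℕ)) ∈ arcsToNat n M ↔ (i, j) ∈ M := by
  simp [mem_arcsToNat, Fin.val_inj]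

theorem mem_avoidingMatchings_iff {n : ℕ} {M : Finset (Fin (2 * n) × Fin (2 * n))} :
    M ∈ avoidingMatchings perm312 n ↔ IsPartialMatching 0 (2 * n) [] (arcsToNat n M) := by
  constructor
  · rintro ⟨⟨-, hlt, hv⟩, hav⟩
    refine ⟨fun i j hij => ?_, fun v hv' => ?_, fun i j i' j' v hij hij' h h' => ?_, ?_, by simp⟩
    · obtain ⟨a, b, hab, rfl, rfl⟩ := mem_arcsToNat.1 hij
      exact ⟨hlt _ hab, Nat.zero_le _, b.2, Or.inr (Nat.zero_le _)⟩
    · have hv2 : v < 2 * n := by simpa using hv'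
      obtain ⟨⟨i, j⟩, ⟨hij, h⟩, -⟩ := hv ⟨v, hv2⟩
      refine ⟨i, j, val_mem_arcsToNat.2 hij, ?_⟩
      simpa [Fin.ext_iff] using h
    · obtain ⟨a, b, hab, rfl, rfl⟩ := mem_arcsToNat.1 hij
      obtain ⟨a', b', hab', rfl, rfl⟩ := mem_arcsToNat.1 hij'
      have hv2 : v < 2 * n := by omega
      have := (hv ⟨v, hv2⟩).unique (y₁ := (a, b)) (y₂ := (a', b'))
        ⟨hab, by simpa [Fin.ext_iff] using h⟩ ⟨hab', by simpa [Fin.ext_iff] using h'⟩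
      simpa [Fin.ext_iff] using this
    · intro o₁ c₁ o₂ c₂ o₃ c₃ h1 h2 h3 h12 h23 h31 hc13 hc32
      obtain ⟨a₁, b₁, h1', rfl, rfl⟩ := mem_arcsToNat.1 h1
      obtain ⟨a₂, b₂, h2', rfl, rfl⟩ := mem_arcsToNat.1 h2
      obtain ⟨a₃, b₃, h3', rfl, rfl⟩ := mem_arcsToNat.1 h3
      exact hav ((containsPattern_perm312_iff M).2
        ⟨a₁, b₁, a₂, b₂, a₃, b₃, h1', h2', h3', h12, h23, h31, hc13, hc32⟩)
  · intro h
    refine ⟨⟨?_, fun ⟨i, j⟩ hij => ?_, fun v => ?_⟩, fun hc => ?_⟩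
    · have := two_mul_card_eq h
      rw [arcsToNat, Finset.card_map] at this
      omega
    · exact (h.arc i j (val_mem_arcsToNat.2 hij)).1
    · obtain ⟨i, j, hij, hv⟩ := h.cover v (Or.inr ⟨Nat.zero_le _, v.2⟩)
      obtain ⟨a, b, hab, rfl, rfl⟩ := mem_arcsToNat.1 hij
      refine ⟨(a, b), ⟨hab, by simpa [Fin.ext_iff] using hv⟩, ?_⟩
      rintro ⟨a', b'⟩ ⟨hab', hv'⟩
      have := h.uniq a' b' a b v (val_mem_arcsToNat.2 hab') hij
        (by simpa [Fin.ext_iff] using hv') hv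
      simpa [Fin.ext_iff] using this
    · obtain ⟨o₁, c₁, o₂, c₂, o₃, c₃, h1, h2, h3, h12, h23, h31, hc13, hc32⟩ :=
        (containsPattern_perm312_iff M).1 hc
      exact h.avoid _ _ _ _ _ _ (val_mem_arcsToNat.2 h1) (val_mem_arcsToNat.2 h2)
        (val_mem_arcsToNat.2 h3) h12 h23 h31 hc13 hc32

theorem numAvoiding_perm312_eq (n : ℕ) : numAvoiding perm312 n = numCompletions (2 * n) [] := by
  have hst : IsState 0 [] := ⟨by simp, by simp, by simp⟩
  have hcard := card_partialMatchings_eq_numCompletions (2 * n) hst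
  rw [zero_add, List.map_nil] at hcard
  rw [← hcard, numAvoiding, ← Set.ncard_coe_finset]
  refine Set.ncard_congr (fun M _ => arcsToNat n M) (fun M hM => ?_) (fun M M' _ _ h => ?_)
    (fun N hN => ?_)
  · exact mem_partialMatchings.2 (mem_avoidingMatchings_iff.1 hM)
  · exact Finset.map_injective _ h
  · have hN' := mem_partialMatchings.1 hN
    have heq : arcsToNat n (Finset.univ.filter fun a => ((a.1 : ℕ), (a.2 : ℕ)) ∈ N) = N := by
      ext ⟨i, j⟩
      rw [mem_arcsToNat]
      constructor
      · rintro ⟨a, b, hab, rfl, rfl⟩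
        simpa using hab
      · intro hij
        have := hN'.arc i j hij
        exact ⟨⟨i, by omega⟩, ⟨j, by omega⟩, by simpa using hij, rfl, rfl⟩
    exact ⟨_, mem_avoidingMatchings_iff.2 (heq.symm ▸ hN'), heq⟩

/-! ### Generating functions of completions -/

/-- The series `∑ u, numCompletions (2 * u + h) D * X ^ u` for a list `D` of block sizes with sum
`h`, written in terms of series `P j` and of the series `A` of the empty state. The term for `j`
collects the completions in which the vertices up to the first one that leaves fewer than `h` open
arcs have the total effect of merging blocks `0, …, j` and removing one element. -/
noncomputable def completionSeries (P : ℕ → ℚ⟦X⟧) (A : ℚ⟦X⟧) : ℕ → List ℕ → ℚ⟦X⟧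
  | 0, _ => A
  | h + 1, D => ∑ j ∈ Finset.range D.length, P j * completionSeries P A h (closeSizes j D)

/-- The list of block sizes after merging blocks `0, …, j`. -/
def mergeSizes (j : ℕ) (D : List ℕ) : List ℕ := (D.take (j + 1)).sum :: D.drop (j + 1)

theorem sum_take_pos {D : List ℕ} (hD : ∀ c ∈ D, 0 < c) (hne : D ≠ []) (j : ℕ) :
    0 < (D.take (j + 1)).sum := by
  obtain ⟨c, D, rfl⟩ := List.exists_cons_of_ne_nil hne
  have := hD c (by simp)
  simp
  omega

theorem closeSizes_zero_one_cons (D : List ℕ) : closeSizes 0 (1 :: D) = D := by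
  simp [closeSizes]

theorem closeSizes_succ_one_cons {D : List ℕ} (hD : ∀ c ∈ D, 0 < c) (hne : D ≠ []) (j : ℕ) :
    closeSizes (j + 1) (1 :: D) = mergeSizes j D := by
  have := sum_take_pos hD hne j
  rw [closeSizes, mergeSizes, List.take_succ_cons, List.sum_cons, List.drop_succ_cons,
    if_neg (by omega), Nat.add_sub_cancel_left]

theorem closeSizes_mergeSizes (i j : ℕ) (D : List ℕ) :
    closeSizes i (mergeSizes j D) = closeSizes (j + i) D := by
  have h1 : ((mergeSizes j D).take (i + 1)).sum = (D.take (j + i + 1)).sum := by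
    have h : D.take (j + 1 + i) = D.take (j + 1) ++ (D.drop (j + 1)).take i := List.take_add
    rw [mergeSizes, List.take_succ_cons, List.sum_cons, show j + i + 1 = (j + 1) + i by omega, h,
      List.sum_append]
  have h2 : (mergeSizes j D).drop (i + 1) = D.drop (j + i + 1) := by
    rw [mergeSizes, List.drop_succ_cons, List.drop_drop]
    congr 1; omega
  rw [closeSizes, h1, h2, closeSizes]

theorem length_mergeSizes {j : ℕ} {D : List ℕ} (hj : j < D.length) :
    (mergeSizes j D).length = D.length - j := by
  rw [mergeSizes, List.length_cons, List.length_drop]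
  omega

theorem pos_closeSizes {D : List ℕ} (hD : ∀ c ∈ D, 0 < c) (hne : D ≠ []) (j : ℕ) :
    ∀ c ∈ closeSizes j D, 0 < c := by
  intro c hc
  have := sum_take_pos hD hne j
  unfold closeSizes at hc
  split_ifs at hc with h
  · exact hD c (List.mem_of_mem_drop hc)
  · rcases List.mem_cons.1 hc with rfl | hc
    · omega
    · exact hD c (List.mem_of_mem_drop hc)

theorem sum_closeSizes {D : List ℕ} (hD : ∀ c ∈ D, 0 < c) (hne : D ≠ []) (j : ℕ) :
    (closeSizes j D).sum + 1 = D.sum := by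
  have h1 := sum_take_pos hD hne j
  have h2 := congrArg List.sum (List.take_append_drop (j + 1) D)
  rw [List.sum_append] at h2
  unfold closeSizes
  split_ifs with h
  · omega
  · rw [List.sum_cons]; omega

/-- `completionSeries` satisfies the recursion that opening or closing an arc imposes on the
completions of a nonempty state. Both sides are linear combinations of the series of the states
`closeSizes k D`, and the hypothesis on `P` is the equality of the coefficients. -/
theorem completionSeries_succ {P : ℕ → ℚ⟦X⟧} (A : ℚ⟦X⟧)
    (hP : ∀ i, P i = 1 + PowerSeries.X *
      (P 0 * P i + ∑ j ∈ Finset.range (i + 1), P (j + 1) * P (i - j)))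
    (h : ℕ) {D : List ℕ} (hD : ∀ c ∈ D, 0 < c) (hne : D ≠ []) :
    completionSeries P A (h + 1) D =
      PowerSeries.X * completionSeries P A (h + 2) (1 :: D) +
        ∑ j ∈ Finset.range D.length, completionSeries P A h (closeSizes j D) := by
  have hmerge : ∀ j ∈ Finset.range D.length, completionSeries P A (h + 1) (mergeSizes j D) =
      ∑ i ∈ Finset.range (D.length - j), P i * completionSeries P A h (closeSizes (j + i) D) := by
    intro j hj
    rw [completionSeries, length_mergeSizes (Finset.mem_range.1 hj)]
    simp only [closeSizes_mergeSizes]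
  have hpush : completionSeries P A (h + 2) (1 :: D) =
      ∑ k ∈ Finset.range D.length,
        (P 0 * P k + ∑ j ∈ Finset.range (k + 1), P (j + 1) * P (k - j)) *
          completionSeries P A h (closeSizes k D) := by
    rw [completionSeries, List.length_cons, Finset.sum_range_succ', closeSizes_zero_one_cons,
      add_comm]
    simp only [closeSizes_succ_one_cons hD hne, add_mul, Finset.sum_add_distrib]
    congr 1
    · rw [completionSeries, Finset.mul_sum]
      simp only [mul_assoc]
    · rw [Finset.sum_congr rfl fun j hj => by rw [hmerge j hj, Finset.mul_sum]]
      -- merging `j` and then `i` further blocks is merging `j + i` blocks: sum along diagonals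
      rw [← Finset.sum_range_diag_flip D.length fun j i =>
        P (j + 1) * (P i * completionSeries P A h (closeSizes (j + i) D))]
      refine Finset.sum_congr rfl fun k _ => ?_
      rw [Finset.sum_mul]
      refine Finset.sum_congr rfl fun j hj => ?_
      have := Finset.mem_range.1 hj
      rw [show j + (k - j) = k by omega, mul_assoc]
  rw [hpush, completionSeries, Finset.mul_sum, ← Finset.sum_add_distrib]
  refine Finset.sum_congr rfl fun k _ => ?_
  conv_lhs => rw [hP k]
  ring

theorem numCompletions_eq_zero (N : ℕ) :
    ∀ {D : List ℕ}, (∀ c ∈ D, 0 < c) → N < D.sum → numCompletions N D = 0 := by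
  induction N with
  | zero =>
    intro D _ h
    rw [numCompletions, if_neg]
    rintro rfl
    simp at h
  | succ N ih =>
    intro D hD h
    have hne : D ≠ [] := by
      rintro rfl
      simp at h
    rw [numCompletions, ih (by simpa using hD) (by rw [List.sum_cons]; omega), zero_add]
    refine Finset.sum_eq_zero fun j _ => ih (pos_closeSizes hD hne j) ?_
    have := sum_closeSizes hD hne j
    omega

theorem numCompletions_eq_coeff {P : ℕ → ℚ⟦X⟧} {A : ℚ⟦X⟧}
    (hP : ∀ i, P i = 1 + PowerSeries.X *
      (P 0 * P i + ∑ j ∈ Finset.range (i + 1), P (j + 1) * P (i - j)))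
    (hA : A = 1 + PowerSeries.X * (P 0 * A)) (N : ℕ) :
    ∀ {D : List ℕ} {u : ℕ}, (∀ c ∈ D, 0 < c) → N = 2 * u + D.sum →
      (numCompletions N D : ℚ) = PowerSeries.coeff u (completionSeries P A D.sum D) := by
  induction N with
  | zero =>
    intro D u hD h
    obtain rfl : D = [] := by
      by_contra hne
      have := sum_closeSizes hD hne 0
      omega
    obtain rfl : u = 0 := by omega
    rw [numCompletions, List.sum_nil, completionSeries, hA]
    simp
  | succ N ih =>
    intro D u hD h
    have hpush : (numCompletions N (1 :: D) : ℚ) = PowerSeries.coeff u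
        (PowerSeries.X * completionSeries P A (1 :: D).sum (1 :: D)) := by
      cases u with
      | zero =>
        rw [numCompletions_eq_zero N (by simpa using hD) (by rw [List.sum_cons]; omega)]
        simp
      | succ u =>
        rw [PowerSeries.coeff_succ_X_mul]
        exact ih (by simpa using hD) (by rw [List.sum_cons]; omega)
    rw [numCompletions, Nat.cast_add, hpush]
    by_cases hne : D = []
    · subst hne
      obtain ⟨u, rfl⟩ : ∃ v, u = v + 1 := ⟨u - 1, by simp at h; omega⟩
      conv_rhs => rw [List.sum_nil, completionSeries, hA]
      simp [completionSeries, PowerSeries.coeff_one]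
    · have hs := sum_closeSizes hD hne
      obtain ⟨h', hh⟩ : ∃ h', D.sum = h' + 1 := ⟨_, (hs 0).symm⟩
      rw [hh, completionSeries_succ A hP h' hD hne, map_add, map_sum, List.sum_cons, hh,
        Nat.cast_sum, add_comm 1 (h' + 1)]
      congr 1
      refine Finset.sum_congr rfl fun j _ => ?_
      have := hs j
      rw [ih (u := u) (pos_closeSizes hD hne j) (by omega), show (closeSizes j D).sum = h' by omega]

/-- Any solution of the recursion for `P` determines the generating function. -/
theorem avoidingGF_perm312_eq {P : ℕ → ℚ⟦X⟧} {A : ℚ⟦X⟧}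
    (hP : ∀ i, P i = 1 + PowerSeries.X *
      (P 0 * P i + ∑ j ∈ Finset.range (i + 1), P (j + 1) * P (i - j)))
    (hA : A = 1 + PowerSeries.X * (P 0 * A)) : avoidingGF perm312 = A := by
  ext n
  rw [avoidingGF, PowerSeries.coeff_mk, numAvoiding_perm312_eq,
    numCompletions_eq_coeff hP hA (2 * n) (D := []) (u := n) (by simp) (by simp)]
  rfl

/-! ### Solution of the functional equation -/

/-- The Catalan series composed with `a`. -/
theorem exists_eq_one_add_mul_sq {S : Type*} [CommRing S] [Algebra ℚ S] (a : S⟦X⟧)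
    (ha : PowerSeries.constantCoeff a = 0) : ∃ c : S⟦X⟧, c = 1 + a * c ^ 2 := by
  have ha' : PowerSeries.HasSubst a := PowerSeries.HasSubst.of_constantCoeff_zero' ha
  have h := congrArg (PowerSeries.map (Nat.castRingHom ℚ))
    PowerSeries.catalanSeries_sq_mul_X_add_one
  have h2 := congrArg (PowerSeries.substAlgHom ha') h
  simp only [map_add, map_mul, map_pow, map_one, PowerSeries.map_X,
    PowerSeries.substAlgHom_X ha'] at h2
  refine ⟨_, h2.symm.trans ?_⟩
  ring

/-- The power series `w = ∑ n, 3 ^ n * catalan n * X ^ n`, the solution of `w = 1 + 3 X w ^ 2`. -/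
noncomputable def wSeries : ℚ⟦X⟧ := PowerSeries.mk fun n => 3 ^ n * (catalan n : ℚ)

theorem wSeries_eq : wSeries = 1 + 3 * PowerSeries.X * wSeries ^ 2 := by
  have hw : wSeries = PowerSeries.rescale (3 : ℚ)
      (PowerSeries.map (Nat.castRingHom ℚ) PowerSeries.catalanSeries) := by
    ext n
    simp [wSeries]
  have h := congrArg (fun f => PowerSeries.rescale (3 : ℚ) (PowerSeries.map (Nat.castRingHom ℚ) f))
    PowerSeries.catalanSeries_sq_mul_X_add_one
  simp only [map_add, map_mul, map_pow, map_one, PowerSeries.map_X, PowerSeries.rescale_X,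
    ← hw] at h
  rw [show (PowerSeries.C (3 : ℚ) : ℚ⟦X⟧) = 3 from rfl] at h
  linear_combination -h

/-- The rational parametrization behind the solution: with `w = 1 + 3 y`, the discriminant of the
quadratic equation for `s` has the double root `t = y (1 - t)`, and the square root of its
remaining factor is expressed through `d`. The coefficient of `hd` contains
`1 - 3 z (1 + 3 y)`, which is the inverse of `1 + 3 y`. -/
theorem kernel_identity {R : Type*} [CommRing R] {z t y d : R} (hy : y = z * (1 + 3 * y) ^ 2)
    (hd : z * (1 + 3 * y) * t * d ^ 2 = (1 - t) * ((1 - y) * d - (1 + 3 * y))) :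
    let M := (1 + 3 * y) * (1 - y)
    let s := 2 * (1 + 3 * y) * t * (1 - t) + M * (1 - t) ^ 2 + t * (t - y * (1 - t)) * d
    z * s ^ 2 - s * (t * (1 - t) + z * M * (1 - t) ^ 2) + t * (1 - t) = 0 := by
  intro M s
  simp only [M, s]
  -- `hd` eliminates `d ^ 2`; what remains is divisible by `y - z * (1 + 3 * y) ^ 2`
  linear_combination t * (t - y * (1 - t)) ^ 2 * (1 - 3 * z * (1 + 3 * y)) * hd +
    (-2 * t + 2 * t * y + t * y * d - 3 * t * y ^ 2 - t * y ^ 2 * d + 2 * t ^ 2 - t ^ 2 * d -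
      t ^ 2 * y * d + 9 * t ^ 2 * y ^ 2 + 3 * t ^ 2 * y ^ 2 * d - 3 * t ^ 2 * z * y ^ 2 * d ^ 2 -
      t ^ 3 + t ^ 3 * d - 6 * t ^ 3 * y - t ^ 3 * y * d - 9 * t ^ 3 * y ^ 2 -
      3 * t ^ 3 * y ^ 2 * d + 6 * t ^ 3 * z * y * d ^ 2 + 6 * t ^ 3 * z * y ^ 2 * d ^ 2 + t ^ 4 +
      4 * t ^ 4 * y + t ^ 4 * y * d + 3 * t ^ 4 * y ^ 2 + t ^ 4 * y ^ 2 * d -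
      3 * t ^ 4 * z * d ^ 2 - 6 * t ^ 4 * z * y * d ^ 2 - 3 * t ^ 4 * z * y ^ 2 * d ^ 2) * hy

/-- The recursion for `P` in closed form. In terms of `P(t) = ∑ i, P i * t ^ i` it reads
`P = 1 / (1 - t) + z (P₀ P + P (P - P₀) / t)`, and for `s = (1 - t) P` it becomes the quadratic
equation of `kernel_identity`. Here `z` and `t` are the inner and the outer variable of
`ℚ⟦X⟧⟦X⟧`. -/
theorem exists_weightSeries : ∃ P : ℕ → ℚ⟦X⟧,
    P 0 = wSeries * (1 - PowerSeries.X * wSeries ^ 2) ∧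
    ∀ i, P i = 1 + PowerSeries.X *
      (P 0 * P i + ∑ j ∈ Finset.range (i + 1), P (j + 1) * P (i - j)) := by
  set w := wSeries with hw
  set y : ℚ⟦X⟧ := PowerSeries.X * w ^ 2 with hy
  have hwy : w = 1 + 3 * y := by rw [hy, ← mul_assoc]; exact wSeries_eq
  -- `k = w / (1 - y)`
  obtain ⟨k, hk⟩ : ∃ k, k * (1 - y) = w :=
    ⟨w * (1 - y)⁻¹, by rw [mul_assoc, PowerSeries.inv_mul_cancel _ (by simp [hy]), mul_one]⟩
  let C : ℚ⟦X⟧ →+* ℚ⟦X⟧⟦X⟧ := PowerSeries.C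
  let t : ℚ⟦X⟧⟦X⟧ := PowerSeries.X
  obtain ⟨u, hu⟩ : ∃ u : ℚ⟦X⟧⟦X⟧, u = PowerSeries.mk 1 := ⟨_, rfl⟩
  have hu1 : u * (1 - t) = 1 := by
    rw [hu]; exact PowerSeries.mk_one_mul_one_sub_eq_one _
  have hC3 : C 3 = 3 := map_ofNat C 3
  -- `d = k * c` solves `d = k + z k d² t / (1 - t)`
  obtain ⟨c, hc⟩ := exists_eq_one_add_mul_sq (C PowerSeries.X * C k ^ 2 * t * u) (by simp [t])
  have hwy' : C w = 1 + 3 * C y := by rw [hwy]; simp [hC3]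
  have hk' : C k * (1 - C y) = 1 + 3 * C y := by rw [← hwy', ← hk]; simp
  have hy' : C y = C PowerSeries.X * (1 + 3 * C y) ^ 2 := by
    rw [← hwy', hy]; simp
  have hd : C PowerSeries.X * (1 + 3 * C y) * t * (C k * c) ^ 2 =
      (1 - t) * ((1 - C y) * (C k * c) - (1 + 3 * C y)) := by
    rw [← hk']
    linear_combination (-(1 - t) * C k * (1 - C y)) * hc -
      (C k * (1 - C y) * C PowerSeries.X * C k ^ 2 * t * c ^ 2) * hu1
  have hs := kernel_identity hy' hd
  set M : ℚ⟦X⟧ := w * (1 - y) with hM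
  have hM' : (1 + 3 * C y) * (1 - C y) = C M := by rw [← hwy', hM]; simp
  simp only [hM'] at hs
  set s := 2 * (1 + 3 * C y) * t * (1 - t) + C M * (1 - t) ^ 2 + t * (t - C y * (1 - t)) * (C k * c)
    with hsdef
  set P := s * u with hP
  have hP0 : PowerSeries.coeff 0 P = M := by
    simp [hP, hsdef, t, C, hu]
  clear_value P s M
  refine ⟨fun i => PowerSeries.coeff i P, hP0, fun i => ?_⟩
  beta_reduce
  obtain ⟨Q, hQ⟩ : ∃ Q : ℚ⟦X⟧⟦X⟧, Q = PowerSeries.mk fun j => PowerSeries.coeff (j + 1) P :=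
    ⟨_, rfl⟩
  have hPQ : P = t * Q + C M := by
    rw [hQ, ← hP0, PowerSeries.coeff_zero_eq_constantCoeff_apply]
    exact PowerSeries.eq_X_mul_shift_add_const P
  -- the quadratic equation for `s`, divided by `t * (1 - t) ^ 2`
  have hmain : P = u + C PowerSeries.X * (C M * P + Q * P) := by
    have hX : t * P = t * (u + C PowerSeries.X * (C M * P + Q * P)) := by
      have h1 : s = P * (1 - t) := by rw [hP, mul_assoc, hu1, mul_one]
      rw [h1] at hs
      have h2 : (1 - t) ^ 2 * (t * P - t * (u + C PowerSeries.X * (C M * P + Q * P))) = 0 := by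
        linear_combination (-1 : ℚ⟦X⟧⟦X⟧) * hs - t * (1 - t) * hu1 +
          (1 - t) ^ 2 * C PowerSeries.X * P * hPQ
      have h3 : (1 - t) ≠ 0 := right_ne_zero_of_mul_eq_one hu1
      exact sub_eq_zero.1 ((mul_eq_zero.1 h2).resolve_left (pow_ne_zero 2 h3))
    exact mul_left_cancel₀ PowerSeries.X_ne_zero hX
  have := congrArg (PowerSeries.coeff i) hmain
  rw [map_add, PowerSeries.coeff_C_mul, map_add, PowerSeries.coeff_C_mul, PowerSeries.coeff_mul,
    Finset.Nat.sum_antidiagonal_eq_sum_range_succ_mk] at this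
  simp only [hQ, hu, PowerSeries.coeff_mk, Pi.one_apply] at this
  rw [hP0]
  exact this

/-! ### The generating function -/

theorem oneSubTwelveXPow_sq : oneSubTwelveXPow ^ 2 = (1 - 12 * PowerSeries.X) ^ 3 := by
  have h : (PowerSeries.binomialSeries ℚ (3 / 2 : ℚ)) ^ 2 = (1 + PowerSeries.X) ^ 3 := by
    rw [sq, ← PowerSeries.binomialSeries_add, ← PowerSeries.binomialSeries_nat (R := ℚ)]
    norm_num
  rw [oneSubTwelveXPow, ← map_pow, h, map_pow, map_add, map_one, PowerSeries.rescale_X,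
    show (PowerSeries.C (-12 : ℚ) : ℚ⟦X⟧) = -12 by rw [map_neg]; rfl]
  ring

theorem constantCoeff_oneSubTwelveXPow : PowerSeries.constantCoeff oneSubTwelveXPow = 1 := by
  rw [← PowerSeries.coeff_zero_eq_constantCoeff_apply, oneSubTwelveXPow, PowerSeries.coeff_rescale]
  simp

/-- `1 - 6 X w` is the square root of `1 - 12 X`. -/
theorem oneSubTwelveXPow_eq :
    oneSubTwelveXPow = (1 - 12 * PowerSeries.X) * (1 - 6 * PowerSeries.X * wSeries) := by
  have hr : (1 - 6 * PowerSeries.X * wSeries) ^ 2 = 1 - 12 * PowerSeries.X := by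
    linear_combination (-12 * PowerSeries.X) * wSeries_eq
  have h : (oneSubTwelveXPow - (1 - 12 * PowerSeries.X) * (1 - 6 * PowerSeries.X * wSeries)) *
      (oneSubTwelveXPow + (1 - 12 * PowerSeries.X) * (1 - 6 * PowerSeries.X * wSeries)) = 0 := by
    linear_combination oneSubTwelveXPow_sq - (1 - 12 * PowerSeries.X) ^ 2 * hr
  rcases mul_eq_zero.1 h with h | h
  · exact sub_eq_zero.1 h
  · have := congrArg PowerSeries.constantCoeff h
    simp [constantCoeff_oneSubTwelveXPow] at this

theorem one_add_sub_oneSubTwelveXPow :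
    1 + 36 * PowerSeries.X - oneSubTwelveXPow = 54 * PowerSeries.X *
      (1 - PowerSeries.X * (wSeries * (1 - PowerSeries.X * wSeries ^ 2))) := by
  rw [oneSubTwelveXPow_eq]
  linear_combination (18 * PowerSeries.X ^ 2 * wSeries + 6 * PowerSeries.X) * wSeries_eq

theorem one_add_sub_oneSubTwelveXPow_ne_zero :
    1 + 36 * PowerSeries.X - oneSubTwelveXPow ≠ 0 := by
  rw [one_add_sub_oneSubTwelveXPow]
  refine mul_ne_zero (mul_ne_zero (fun h => ?_) PowerSeries.X_ne_zero) fun h => ?_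
  · have := congrArg PowerSeries.constantCoeff h
    rw [map_ofNat, map_zero] at this
    norm_num at this
  · simpa using congrArg PowerSeries.constantCoeff h

theorem avoidingGF_mul :
    avoidingGF perm312 * (1 + 36 * PowerSeries.X - oneSubTwelveXPow) = 54 * PowerSeries.X := by
  obtain ⟨P, hP0, hP⟩ := exists_weightSeries
  have hinv : (1 - PowerSeries.X * P 0)⁻¹ * (1 - PowerSeries.X * P 0) = 1 :=
    PowerSeries.inv_mul_cancel _ (by simp)
  rw [avoidingGF_perm312_eq (A := (1 - PowerSeries.X * P 0)⁻¹) hP (by linear_combination hinv),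
    one_add_sub_oneSubTwelveXPow, ← hP0]
  linear_combination (54 * PowerSeries.X) * hinv

/-- The generating function with the radical in the numerator. Rationalizing works because
`(1 + 36 X)² - (1 - 12 X)³ = 108 X (1 + 4 X)²`. -/
theorem two_mul_avoidingGF :
    2 * (1 + 4 * PowerSeries.X) ^ 2 * avoidingGF perm312 =
      1 + 36 * PowerSeries.X + oneSubTwelveXPow := by
  refine mul_right_cancel₀ one_add_sub_oneSubTwelveXPow_ne_zero ?_
  linear_combination 2 * (1 + 4 * PowerSeries.X) ^ 2 * avoidingGF_mul + oneSubTwelveXPow_sq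

theorem coeff_oneSubTwelveXPow (n : ℕ) : PowerSeries.coeff (n + 2) oneSubTwelveXPow =
    108 * 3 ^ n * (catalan n : ℚ) / (n + 2) := by
  have hT : oneSubTwelveXPow = 1 + PowerSeries.X *
      (PowerSeries.C (-12) + PowerSeries.C (-6) * wSeries +
        PowerSeries.X * (PowerSeries.C 72 * wSeries)) := by
    rw [oneSubTwelveXPow_eq]
    simp only [map_neg, map_ofNat]
    ring
  have hcat : ((n : ℚ) + 2) * catalan (n + 1) = 2 * (2 * n + 1) * catalan n := by
    have h1 := succ_mul_catalan_eq_centralBinom n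
    have h2 := succ_mul_catalan_eq_centralBinom (n + 1)
    have h3 := Nat.succ_mul_centralBinom_succ n
    have h1' : ((n : ℚ) + 1) * catalan n = n.centralBinom := by exact_mod_cast h1
    have h2' : ((n : ℚ) + 1 + 1) * catalan (n + 1) = (n + 1).centralBinom := by exact_mod_cast h2
    have h3' : ((n : ℚ) + 1) * (n + 1).centralBinom = 2 * (2 * n + 1) * n.centralBinom := by
      exact_mod_cast h3
    have h4 : (n : ℚ) + 1 ≠ 0 := by positivity
    refine mul_left_cancel₀ h4 ?_
    linear_combination (n + 1 : ℚ) * h2' + h3' - 2 * (2 * n + 1) * h1'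
  rw [hT, map_add, PowerSeries.coeff_succ_X_mul, map_add, map_add, PowerSeries.coeff_succ_X_mul,
    PowerSeries.coeff_C_mul, PowerSeries.coeff_C_mul]
  simp only [wSeries, PowerSeries.coeff_mk, PowerSeries.coeff_one, PowerSeries.coeff_C]
  have h5 : (n : ℚ) + 2 ≠ 0 := by positivity
  simp only [Nat.add_eq_zero_iff, one_ne_zero, and_false, if_false, OfNat.ofNat_ne_zero]
  field_simp
  linear_combination (-18 * 3 ^ n : ℚ) * hcat

theorem numAvoiding_perm312_recurrence (n : ℕ) :
    (numAvoiding perm312 (n + 2) : ℝ) + 8 * numAvoiding perm312 (n + 1) +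
      16 * numAvoiding perm312 n = 54 * 3 ^ n * catalan n / (n + 2) := by
  have h := congrArg (PowerSeries.coeff (n + 2)) two_mul_avoidingGF
  have h1 : 2 * (1 + 4 * PowerSeries.X) ^ 2 * avoidingGF perm312 =
      PowerSeries.C 2 * (avoidingGF perm312 + PowerSeries.X * (PowerSeries.C 8 * avoidingGF perm312
        + PowerSeries.X * (PowerSeries.C 16 * avoidingGF perm312))) := by
    simp only [map_ofNat]
    ring
  have h2 : 1 + 36 * PowerSeries.X + oneSubTwelveXPow =
      1 + PowerSeries.X * PowerSeries.C 36 + oneSubTwelveXPow := by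
    simp only [map_ofNat]
    ring
  rw [h1, h2, PowerSeries.coeff_C_mul, map_add, map_add, map_add, PowerSeries.coeff_succ_X_mul,
    PowerSeries.coeff_succ_X_mul, map_add, PowerSeries.coeff_succ_X_mul, PowerSeries.coeff_C_mul,
    PowerSeries.coeff_C_mul, coeff_oneSubTwelveXPow] at h
  simp only [avoidingGF, PowerSeries.coeff_mk, PowerSeries.coeff_one, PowerSeries.coeff_C,
    Nat.add_eq_zero_iff, one_ne_zero, and_false, if_false, OfNat.ofNat_ne_zero] at h
  have h3 : (numAvoiding perm312 (n + 2) : ℚ) + 8 * numAvoiding perm312 (n + 1) +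
      16 * numAvoiding perm312 n = 54 * 3 ^ n * catalan n / (n + 2) := by
    linear_combination h / 2
  have h4 := congrArg (Rat.cast (K := ℝ)) h3
  push_cast at h4
  exact h4

/-! ### Asymptotics -/

open scoped Topology in
/-- A sequence that contracts up to an error tending to zero tends to zero. -/
theorem tendsto_zero_of_le_mul_add {e δ : ℕ → ℝ} {q : ℝ} (hq0 : 0 ≤ q) (hq : q < 1)
    (he : ∀ n, 0 ≤ e n) (hδ : Tendsto δ atTop (𝓝 0))
    (h : ∀ᶠ n in atTop, e (n + 1) ≤ q * e n + δ n) : Tendsto e atTop (𝓝 0) := by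
  rw [Metric.tendsto_atTop]
  intro ε hε
  obtain ⟨N, hN⟩ := eventually_atTop.1
    (h.and (hδ.eventually (gt_mem_nhds (show 0 < (1 - q) * (ε / 2) by nlinarith))))
  have hind : ∀ k, e (N + k) ≤ ε / 2 + q ^ k * e N := by
    intro k
    induction k with
    | zero => simp; linarith
    | succ k ih =>
      have h1 := hN (N + k) (by omega)
      have h2 := mul_le_mul_of_nonneg_left ih hq0
      rw [← add_assoc, pow_succ]
      linarith [h1.1, h1.2]
  have hlim : Tendsto (fun k => q ^ k * e N) atTop (𝓝 0) := by
    simpa using (tendsto_pow_atTop_nhds_zero_of_lt_one hq0 hq).mul_const (e N)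
  obtain ⟨K, hK⟩ := eventually_atTop.1 (hlim.eventually (gt_mem_nhds (half_pos hε)))
  refine ⟨N + K, fun n hn => ?_⟩
  have h1 := hind (n - N)
  rw [show N + (n - N) = n by omega] at h1
  rw [Real.dist_0_eq_abs, abs_of_nonneg (he n)]
  linarith [hK (n - N) (by omega)]

open scoped Topology in
/-- Convergence passes from `r n * x (n + 1) + μ * x n` to `x` if `μ` is less than the limit of
`r`. -/
theorem tendsto_of_tendsto_mul_succ_add {x r : ℕ → ℝ} {ρ μ L : ℝ} (hμ : 0 ≤ μ) (hμρ : μ < ρ)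
    (hr : Tendsto r atTop (𝓝 ρ))
    (h : Tendsto (fun n => r n * x (n + 1) + μ * x n) atTop (𝓝 L)) :
    Tendsto x atTop (𝓝 (L / (ρ + μ))) := by
  have hρ : 0 < ρ := hμ.trans_lt hμρ
  set l := L / (ρ + μ) with hl
  have hlL : L - (ρ + μ) * l = 0 := by rw [hl]; field_simp; ring
  rw [tendsto_iff_norm_sub_tendsto_zero]
  obtain ⟨q, hq1, hq2⟩ := exists_between ((div_lt_one hρ).2 hμρ)
  have hδ : Tendsto (fun n => |(r n * x (n + 1) + μ * x n - (r n + μ) * l) / r n|) atTop (𝓝 0) := by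
    have := ((h.sub ((hr.add_const μ).mul_const l)).div hr hρ.ne').abs
    rwa [hlL, zero_div, abs_zero] at this
  refine tendsto_zero_of_le_mul_add ((div_nonneg hμ hρ.le).trans hq1.le) hq2
    (fun n => norm_nonneg _) hδ ?_
  have hdiv : Tendsto (fun n => μ / r n) atTop (𝓝 (μ / ρ)) := tendsto_const_nhds.div hr hρ.ne'
  filter_upwards [hr.eventually (lt_mem_nhds hρ), hdiv.eventually (gt_mem_nhds hq1)] with n h1 h2
  -- the deviation from the limit contracts by the factor `μ / r n`, up to an error
  have heq : x (n + 1) - l = -(μ / r n) * (x n - l) +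
      (r n * x (n + 1) + μ * x n - (r n + μ) * l) / r n := by
    field_simp
    ring
  rw [heq, Real.norm_eq_abs, Real.norm_eq_abs]
  refine (abs_add_le _ _).trans (add_le_add_left ?_ _)
  rw [abs_mul, abs_neg, abs_of_nonneg (div_nonneg hμ h1.le)]
  exact mul_le_mul_of_nonneg_right h2.le (abs_nonneg _)

open scoped Topology in
/-- `centralBinom n ~ 4 ^ n / √(π n)`: the sequence is `stirlingSeq (2 n) / stirlingSeq n ^ 2`. -/
theorem tendsto_centralBinom_mul_sqrt_div :
    Tendsto (fun n : ℕ => (n.centralBinom : ℝ) * √n / 4 ^ n) atTop (𝓝 (1 / √Real.pi)) := by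
  have h := Stirling.tendsto_stirlingSeq_sqrt_pi
  have hpi : √Real.pi ≠ 0 := by positivity
  have h2 : Tendsto (fun n : ℕ => Stirling.stirlingSeq (2 * n)) atTop (𝓝 √Real.pi) :=
    h.comp (tendsto_id.const_mul_atTop' two_pos)
  have h3 := h2.div (h.pow 2) (pow_ne_zero 2 hpi)
  rw [show √Real.pi / √Real.pi ^ 2 = 1 / √Real.pi by field_simp] at h3
  refine h3.congr' ?_
  filter_upwards [eventually_gt_atTop 0] with n hn
  have hn' : (0 : ℝ) < n := by exact_mod_cast hn
  have hcb : (n.centralBinom : ℝ) = (2 * n).factorial / (n.factorial : ℝ) ^ 2 := by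
    rw [Nat.centralBinom_eq_two_mul_choose, Nat.cast_choose ℝ (by omega),
      show 2 * n - n = n by omega, sq]
  have hs1 : √(2 * ((2 * n : ℕ) : ℝ)) = 2 * √n := by
    rw [show 2 * ((2 * n : ℕ) : ℝ) = 2 ^ 2 * n by push_cast; ring, Real.sqrt_mul (by norm_num),
      Real.sqrt_sq (by norm_num)]
  have hs2 : √(2 * (n : ℝ)) ^ 2 = 2 * √n * √n := by
    rw [Real.sq_sqrt (by positivity), mul_assoc, Real.mul_self_sqrt hn'.le]
  have hp : (((2 * n : ℕ) : ℝ) / Real.exp 1) ^ (2 * n) =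
      4 ^ n * ((n / Real.exp 1) ^ n) ^ 2 := by
    rw [← pow_mul, mul_comm n 2, show (4 : ℝ) ^ n = 2 ^ (2 * n) by rw [pow_mul]; norm_num,
      ← mul_pow]
    push_cast
    ring
  have hsn : √(n : ℝ) ≠ 0 := by positivity
  rw [Pi.div_apply, Stirling.stirlingSeq, Stirling.stirlingSeq, hcb, hs1, hp,
    div_pow (n.factorial : ℝ), mul_pow √(2 * (n : ℝ)), hs2]
  have : (n : ℝ) / Real.exp 1 ≠ 0 := by positivity
  field_simp

/-- The order of growth `12 ^ n * n ^ (-5 / 2)`; its value at `n = 0` is the junk value `0`. -/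
noncomputable def growth (n : ℕ) : ℝ := 12 ^ n / √((n : ℝ) ^ 5)

theorem growth_pos {n : ℕ} (hn : 0 < n) : 0 < growth n := by
  have : (0 : ℝ) < n := by exact_mod_cast hn
  unfold growth
  positivity

open scoped Topology in
theorem tendsto_growth_ratio : Tendsto (fun n => growth (n + 1) / growth n) atTop (𝓝 12) := by
  have h : Tendsto (fun n : ℕ => 12 * √(((n : ℝ) / (n + 1)) ^ 5)) atTop (𝓝 (12 * √(1 ^ 5))) :=
    (((tendsto_natCast_div_add_atTop (1 : ℝ)).pow 5).sqrt).const_mul 12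
  simp only [one_pow, Real.sqrt_one, mul_one] at h
  refine h.congr' ?_
  filter_upwards [eventually_gt_atTop 0] with n hn
  have hn' : (0 : ℝ) < n := by exact_mod_cast hn
  rw [growth, growth, div_pow, Real.sqrt_div (by positivity)]
  push_cast
  have h1 : √((n : ℝ) ^ 5) ≠ 0 := by positivity
  have h2 : √((n + 1 : ℝ) ^ 5) ≠ 0 := by positivity
  field_simp
  ring

open scoped Topology in
/-- Division by `1 + 4 X` keeps the order of growth, since the singularity at `-1 / 4` is farther
from the origin than `1 / 12`. The constant is `12 + 4`. -/
theorem tendsto_div_growth {b : ℕ → ℝ} {L : ℝ}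
    (h : Tendsto (fun n => (b (n + 1) + 4 * b n) / growth n) atTop (𝓝 L)) :
    Tendsto (fun n => b n / growth n) atTop (𝓝 (L / 16)) := by
  rw [show (16 : ℝ) = 12 + 4 by norm_num]
  refine tendsto_of_tendsto_mul_succ_add (by norm_num) (by norm_num) tendsto_growth_ratio
    (h.congr' ?_)
  filter_upwards [eventually_gt_atTop 0] with n hn
  have h1 := (growth_pos hn).ne'
  have h2 := (growth_pos n.succ_pos).ne'
  simp only [Nat.succ_eq_add_one] at h2
  field_simp

open scoped Topology in
theorem tendsto_catalan_div_growth :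
    Tendsto (fun n : ℕ => 54 * 3 ^ n * (catalan n : ℝ) / (n + 2) / growth n) atTop
      (𝓝 (54 / √Real.pi)) := by
  have h := ((tendsto_centralBinom_mul_sqrt_div.mul (tendsto_natCast_div_add_atTop (1 : ℝ))).mul
    (tendsto_natCast_div_add_atTop (2 : ℝ))).const_mul 54
  rw [show 54 * (1 / √Real.pi * 1 * 1) = 54 / √Real.pi by ring] at h
  refine h.congr' ?_
  filter_upwards [eventually_gt_atTop 0] with n hn
  have hn' : (0 : ℝ) < n := by exact_mod_cast hn
  have hcat : (n.centralBinom : ℝ) = (n + 1) * catalan n := by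
    exact_mod_cast (succ_mul_catalan_eq_centralBinom n).symm
  have hs : √((n : ℝ) ^ 5) = n ^ 2 * √n := by
    rw [show (n : ℝ) ^ 5 = (n ^ 2) ^ 2 * n by ring, Real.sqrt_mul (by positivity),
      Real.sqrt_sq (by positivity)]
  rw [growth, hcat, hs, show (12 : ℝ) ^ n = 3 ^ n * 4 ^ n by rw [← mul_pow]; norm_num]
  field_simp

theorem numAvoiding_perm312_isEquivalent :
    (fun n : ℕ => (numAvoiding perm312 n : ℝ)) ~[atTop]
      (fun n : ℕ => 3 ^ 3 / (2 ^ 7 * Real.sqrt (Real.pi * (n : ℝ) ^ 5)) * 12 ^ n) := by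
  have h := tendsto_div_growth (b := fun n => (numAvoiding perm312 n : ℝ))
    (tendsto_div_growth
      (b := fun n => (numAvoiding perm312 (n + 1) : ℝ) + 4 * numAvoiding perm312 n)
      (tendsto_catalan_div_growth.congr fun n => by
        rw [← numAvoiding_perm312_recurrence]
        ring))
  have hpi : √Real.pi ≠ 0 := by positivity
  have hv : ∀ n : ℕ, 3 ^ 3 / (2 ^ 7 * √(Real.pi * (n : ℝ) ^ 5)) * 12 ^ n =
      54 / √Real.pi / 16 / 16 * growth n := by
    intro n
    rw [growth, Real.sqrt_mul Real.pi_pos.le]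
    ring
  rw [isEquivalent_iff_tendsto_one]
  · have h2 := h.div_const (54 / √Real.pi / 16 / 16)
    rw [div_self (by positivity)] at h2
    refine h2.congr fun n => ?_
    rw [Pi.div_apply, hv, div_div, mul_comm (growth n)]
  · filter_upwards [eventually_gt_atTop 0] with n hn
    rw [hv]
    have := growth_pos hn
    positivity

theorem mainTheorem1 :
    (∀ n : ℕ, numAvoiding perm231 n = numAvoiding perm312 n) ∧
    (1 + 36 * PowerSeries.X - oneSubTwelveXPow ≠ 0 ∧
      (avoidingGF perm312 : ℚ⸨X⸩) =
        ((54 * PowerSeries.X : ℚ⟦X⟧) : ℚ⸨X⸩) /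
          ((1 + 36 * PowerSeries.X - oneSubTwelveXPow : ℚ⟦X⟧) : ℚ⸨X⸩)) ∧
    (fun n : ℕ => (numAvoiding perm312 n : ℝ)) ~[atTop]
      (fun n : ℕ => 3 ^ 3 / (2 ^ 7 * Real.sqrt (Real.pi * (n : ℝ) ^ 5)) * 12 ^ n) := by
  refine ⟨numAvoiding_perm231, ⟨one_add_sub_oneSubTwelveXPow_ne_zero, ?_⟩,
    numAvoiding_perm312_isEquivalent⟩
  rw [eq_div_iff, ← map_mul, avoidingGF_mul]
  rw [Ne, map_eq_zero_iff _ HahnSeries.ofPowerSeries_injective]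
  exact one_add_sub_oneSubTwelveXPow_ne_zero
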